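/- Let $\mathbb H$ be the real quaternions, $\mathbb S=\{J\in\mathbb H: J^2=-1\}$ and $\mathbb C_J=\mathbb R+\mathbb R J$ for $J\in\mathbb S$. Let $\mathbb H[q_1,\dots,q_n]$ be the ring of slice regular polynomials $P=\sum_{\ell} q_1^{\ell_1}\cdots q_n^{\ell_n}\,c_\ell$ (finite sums over $\ell\in\mathbb N^n$, with $c_\ell\in\mathbb H$), with the usual addition and with the slice product $*$, the biadditive product determined by $$(q_1^{\ell_1}\cdots q_n^{\ell_n}a)*(q_1^{m_1}\cdots q_n^{m_n}b)=q_1^{\ell_1+m_1}\cdots q_n^{\ell_n+m_n}\,ab .$$ The value of $P$ at $(a_1,\dots,a_n)\in\mathbb H^n$ is $P(a_1,\dots,a_n)=\sum_\ell a_1^{\ell_1}\cdots a_n^{\ell_n}c_\ell$, with the factors in this order. For a right ideal $I$ of $\mathbb H[q_1,\dots,q_n]$ put $$\mathcal V(I)=\{a\in\mathbb H^n: P(a)=0\text{ for all }P\in I\},\qquad \mathcal V_c(I)=\mathcal V(I)\cap\bigcup_{J\in\mathbb S}(\mathbb C_J)^n ,$$ and for $Z\subseteq\mathbb H^n$ let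 $\mathcal J(Z)$ be the right ideal of $\mathbb H[q_1,\dots,q_n]$ generated by the slice regular polynomials that vanish on $Z$. **Theorem.** Let $I$ be a right ideal in $\mathbb H[q_1,\dots,q_n]$. Then the right ideal $\mathcal J(\mathcal V_c(I))$ is contained in the set of slice regular polynomials vanishing on $\mathcal V(I)$; that is, every $P\in\mathcal J(\mathcal V_c(I))$ satisfies $P(a)=0$ for all $a\in\mathcal V(I)$. -/

import Mathlib

open scoped Quaternion

noncomputable section

namespace SliceRegular

/-- The ring `ℍ[q₁, …, qₙ]` of slice regular polynomials in `n` quaternionic variables.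
An element is the finite family of its coefficients `c_ℓ ∈ ℍ`, indexed by multi-exponents
`ℓ ∈ ℕⁿ`. The product is the slice product: the variables are central, so that
`(q^ℓ a) * (q^m b) = q^(ℓ + m) (a b)`. -/
abbrev SlicePoly (n : ℕ) : Type := AddMonoidAlgebra ℍ[ℝ] (Fin n →₀ ℕ)

/-- A right ideal of `ℍ[q₁, …, qₙ]`: an additive subgroup closed under `P ↦ P * Q`. -/
abbrev RightIdeal (n : ℕ) : Type := Submodule (SlicePoly n)ᵐᵒᵖ (SlicePoly n)

/-- The value of `P = ∑ q^ℓ c_ℓ` at `a = (a₁, …, aₙ) ∈ ℍⁿ`, namely the sum over `ℓ` of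
`a₁^ℓ₁ a₂^ℓ₂ ⋯ aₙ^ℓₙ c_ℓ`, the factors in this order. -/
def eval {n : ℕ} (a : Fin n → ℍ[ℝ]) (P : SlicePoly n) : ℍ[ℝ] :=
  P.coeff.sum fun ℓ c => (List.ofFn fun i => a i ^ ℓ i).prod * c

/-- The slice regular polynomials that vanish on every point of `Z ⊆ ℍⁿ`. -/
def vanishingOn {n : ℕ} (Z : Set (Fin n → ℍ[ℝ])) : Set (SlicePoly n) :=
  {P | ∀ a ∈ Z, eval a P = 0}

/-- `𝒥(Z)`, the right ideal generated by the slice regular polynomials vanishing on `Z`. -/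
def idealJ {n : ℕ} (Z : Set (Fin n → ℍ[ℝ])) : RightIdeal n :=
  Submodule.span (SlicePoly n)ᵐᵒᵖ (vanishingOn Z)

/-- `𝒱(I)`, the set of common zeros in `ℍⁿ` of the polynomials in `I`. -/
def zeroLocus {n : ℕ} (I : RightIdeal n) : Set (Fin n → ℍ[ℝ]) :=
  {a | ∀ P ∈ I, eval a P = 0}

/-- The sphere `𝕊` of quaternionic imaginary units. -/
def imaginaryUnits : Set ℍ[ℝ] := {J | J ^ 2 = -1}

/-- The slice `ℂ_J = ℝ + ℝ J`. -/
def slice (J : ℍ[ℝ]) : Set ℍ[ℝ] := {q | ∃ x y : ℝ, q = (x : ℍ[ℝ]) + (y : ℍ[ℝ]) * J}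

/-- `𝒱_c(I)`, the set of points of `𝒱(I)` whose coordinates all lie in one common slice. -/
def sliceZeroLocus {n : ℕ} (I : RightIdeal n) : Set (Fin n → ℍ[ℝ]) :=
  zeroLocus I ∩ ⋃ J ∈ imaginaryUnits, {a | ∀ i, a i ∈ slice J}

end SliceRegular

end

/-!
Polynomials vanishing on `𝒱_c(I)` already form a right ideal, since on a slice the coordinates
commute and `(P * q^m c)(b) = b^m P(b) c`. So it suffices that a polynomial `P` vanishing on
`𝒱_c(I)` vanishes at every `a ∈ 𝒱(I)`, also when the coordinates of `a` do not commute.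

Let `pointIdeal a` be the largest right ideal of polynomials vanishing at `a`. It contains `I`, and
modulo it each variable `qᵢ` satisfies a real quadratic equation whose complex roots are distinct
(`pointIdeal_quadratic`): the equation of the conjugacy class of `aᵢ` if `aᵢ` is not real, and
`(x - aᵢ)(x - aᵢ - 1)` if it is. Thus the commuting operators `qᵢ` on `ℍ[q₁, …, qₙ] / pointIdeal a`
are simultaneously diagonalizable over `ℂ ⊆ ℍ`, acting on the right
(`one_mem_of_eigenvectors_mem`).

Suppose `P ∉ pointIdeal a` and take a right ideal `M ⊇ pointIdeal a` maximal among those missing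
`P`. An eigenvector `v ∉ M` exists, and `v ℍ + M` is a right ideal, so by maximality it contains
`P`. This holds for every eigenvector outside `M`, hence all of them, and so `1`, lie in `v ℍ + M`.
Then `v` is congruent to a nonzero constant `g`, and `qᵢ` to `bᵢ = g zᵢ g⁻¹`, where the `zᵢ ∈ ℂ`
are the eigenvalues of `v` (`exists_slice_point_of_maximal`). The point `b` lies on one slice and
`Q - Q(b) ∈ M` for all `Q`. As `M` is proper, the elements of `I ⊆ M` vanish at `b`, so
`b ∈ 𝒱_c(I)`, `P(b) = 0` and `P ∈ M`, a contradiction.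
-/

noncomputable section

namespace SliceRegular

open Quaternion

variable {n : ℕ}

/-! ### Monomials, constants and evaluation -/

/-- The constant polynomial with value `h`. -/
abbrev const (h : ℍ[ℝ]) : SlicePoly n := AddMonoidAlgebra.single 0 h

/-- The monic monomial `q^ℓ`. -/
abbrev mono (l : Fin n →₀ ℕ) : SlicePoly n := AddMonoidAlgebra.single l 1

/-- The variable `qᵢ`. -/
abbrev var (i : Fin n) : SlicePoly n := mono (Finsupp.single i 1)

lemma mono_add (l m : Fin n →₀ ℕ) : (mono (l + m) : SlicePoly n) = mono l * mono m := by
  simp [AddMonoidAlgebra.single_mul_single]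

lemma const_mul (g h : ℍ[ℝ]) : (const (g * h) : SlicePoly n) = const g * const h := by
  simp [AddMonoidAlgebra.single_mul_single]

lemma const_add (g h : ℍ[ℝ]) : (const (g + h) : SlicePoly n) = const g + const h :=
  AddMonoidAlgebra.single_add _ _ _

lemma const_sub (g h : ℍ[ℝ]) : (const (g - h) : SlicePoly n) = const g - const h :=
  AddMonoidAlgebra.single_sub _ _ _

lemma const_neg (g : ℍ[ℝ]) : (const (-g) : SlicePoly n) = -const g :=
  AddMonoidAlgebra.single_neg _ _

lemma const_ofComplex_mul_comm (x y : ℂ) :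
    (const (ofComplex x) * const (ofComplex y) : SlicePoly n) =
      const (ofComplex y) * const (ofComplex x) := by
  rw [← const_mul, ← const_mul, ← map_mul, ← map_mul, mul_comm]

lemma mono_mul_comm (l : Fin n →₀ ℕ) (P : SlicePoly n) : mono l * P = P * mono l :=
  AddMonoidAlgebra.single_commute (fun m => AddCommute.all l m) (fun r => Commute.one_left r) P

lemma RightIdeal.mul_mem (M : RightIdeal n) {P : SlicePoly n} (hP : P ∈ M) (Q : SlicePoly n) :
    P * Q ∈ M :=
  M.smul_mem (MulOpposite.op Q) hP

lemma RightIdeal.mono_mul_mem (M : RightIdeal n) {P : SlicePoly n} (hP : P ∈ M)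
    (l : Fin n →₀ ℕ) : mono l * P ∈ M := by
  rw [mono_mul_comm]
  exact M.mul_mem hP _

lemma eval_single (a : Fin n → ℍ[ℝ]) (l : Fin n →₀ ℕ) (c : ℍ[ℝ]) :
    eval a (AddMonoidAlgebra.single l c) = (List.ofFn fun i => a i ^ l i).prod * c := by
  simp [eval]

lemma eval_add (a : Fin n → ℍ[ℝ]) (P Q : SlicePoly n) :
    eval a (P + Q) = eval a P + eval a Q := by
  simp only [eval, AddMonoidAlgebra.coeff_add]
  exact Finsupp.sum_add_index' (by simp) (by simp [mul_add])

/-- Evaluation at `a`, which is additive but in general not multiplicative. -/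
def evalHom (a : Fin n → ℍ[ℝ]) : SlicePoly n →+ ℍ[ℝ] := AddMonoidHom.mk' (eval a) (eval_add a)

lemma eval_zero (a : Fin n → ℍ[ℝ]) : eval a 0 = 0 := (evalHom a).map_zero

lemma eval_sub (a : Fin n → ℍ[ℝ]) (P Q : SlicePoly n) :
    eval a (P - Q) = eval a P - eval a Q := (evalHom a).map_sub P Q

lemma eval_mul_const (a : Fin n → ℍ[ℝ]) (P : SlicePoly n) (h : ℍ[ℝ]) :
    eval a (P * const h) = eval a P * h := by
  induction P using AddMonoidAlgebra.induction_linear with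
  | zero => simp [eval_zero]
  | add P Q hP hQ => simp [add_mul, eval_add, hP, hQ]
  | single l c => simp [AddMonoidAlgebra.single_mul_single, eval_single, mul_assoc]

/-! ### Points on a slice -/

lemma eval_single_slice (φ : ℂ →ₐ[ℝ] ℍ[ℝ]) (z : Fin n → ℂ) (l : Fin n →₀ ℕ) (c : ℍ[ℝ]) :
    eval (fun i => φ (z i)) (AddMonoidAlgebra.single l c) = φ (∏ i, z i ^ l i) * c := by
  rw [eval_single, ← List.prod_ofFn, map_list_prod, List.map_ofFn]
  simp [Function.comp_def]

/-- At a point with all coordinates in one slice, the zero set of evaluation is a right ideal: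
the coordinates commute, so `(P * q^m c)(b) = b^m P(b) c`. -/
lemma eval_mul_eq_zero (φ : ℂ →ₐ[ℝ] ℍ[ℝ]) (z : Fin n → ℂ) {P : SlicePoly n}
    (hP : eval (fun i => φ (z i)) P = 0) (Q : SlicePoly n) :
    eval (fun i => φ (z i)) (P * Q) = 0 := by
  induction Q using AddMonoidAlgebra.induction_linear with
  | zero => simp [eval_zero]
  | add Q R hQ hR => simp [mul_add, eval_add, hQ, hR]
  | single m c =>
    have key : ∀ R : SlicePoly n, eval (fun i => φ (z i)) (R * AddMonoidAlgebra.single m c) =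
        φ (∏ i, z i ^ m i) * eval (fun i => φ (z i)) R * c := by
      intro R
      induction R using AddMonoidAlgebra.induction_linear with
      | zero => simp [eval_zero]
      | add Q R hQ hR => simp [mul_add, add_mul, eval_add, hQ, hR]
      | single l d =>
        rw [AddMonoidAlgebra.single_mul_single, eval_single_slice, eval_single_slice, add_comm l m]
        simp only [Finsupp.add_apply, pow_add, Finset.prod_mul_distrib, map_mul, mul_assoc]
    rw [key, hP]
    simp

lemma exists_algHom_of_mem_slice {J : ℍ[ℝ]} (hJ : J ∈ imaginaryUnits) {b : Fin n → ℍ[ℝ]}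
    (hb : ∀ i, b i ∈ slice J) :
    ∃ (φ : ℂ →ₐ[ℝ] ℍ[ℝ]) (z : Fin n → ℂ), b = fun i => φ (z i) := by
  choose x y h using hb
  have hJ' : J * J = -1 := by rw [← pow_two]; exact hJ
  refine ⟨Complex.liftAux J hJ', fun i => ⟨x i, y i⟩, funext fun i => ?_⟩
  rw [h i, Complex.liftAux_apply, Quaternion.coe_mul_eq_smul]
  rfl

lemma mem_slice_algHom (φ : ℂ →ₐ[ℝ] ℍ[ℝ]) : φ Complex.I ∈ imaginaryUnits ∧
    ∀ z, φ z ∈ slice (φ Complex.I) := by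
  refine ⟨?_, fun z => ⟨z.re, z.im, ?_⟩⟩
  · change φ Complex.I ^ 2 = -1
    rw [← map_pow, Complex.I_sq, map_neg, map_one]
  · have hz : z = algebraMap ℝ ℂ z.re + z.im • Complex.I := by
      simp [Complex.re_add_im]
    conv_lhs => rw [hz]
    rw [map_add, map_smul, AlgHom.commutes, Quaternion.coe_mul_eq_smul]
    rfl

lemma idealJ_sliceZeroLocus_subset (I : RightIdeal n) :
    (idealJ (sliceZeroLocus I) : Set (SlicePoly n)) ⊆ vanishingOn (sliceZeroLocus I) := by
  intro P hP b hb
  refine Submodule.span_induction (p := fun P _ => eval b P = 0)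
    (fun P (hP : P ∈ vanishingOn _) => hP b hb) (eval_zero b)
    (fun P Q _ _ hP hQ => by rw [eval_add, hP, hQ, add_zero]) ?_ hP
  intro Q P _ hP
  obtain ⟨J, hJ, hbJ⟩ := Set.mem_iUnion₂.1 hb.2
  obtain ⟨φ, z, rfl⟩ := exists_algHom_of_mem_slice hJ hbJ
  exact eval_mul_eq_zero φ z hP Q.unop

/-! ### Eigenvectors of the variables modulo a right ideal -/

/-- If each variable acts on the class of `v` modulo `M` as right multiplication by a number of
one slice, then every polynomial acts as right multiplication by its value at that point. -/
lemma mul_sub_mul_const_eval_mem (M : RightIdeal n) (φ : ℂ →ₐ[ℝ] ℍ[ℝ]) (z : Fin n → ℂ)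
    {v : SlicePoly n} (hv : ∀ i, var i * v - v * const (φ (z i)) ∈ M) (Q : SlicePoly n) :
    v * Q - v * const (eval (fun i => φ (z i)) Q) ∈ M := by
  let w (l : Fin n →₀ ℕ) : ℂ := ∏ i, z i ^ l i
  have hw : ∀ l m, w (l + m) = w l * w m := fun l m => by
    simp [w, pow_add, Finset.prod_mul_distrib]
  have hadd : ∀ l m, mono l * v - v * const (φ (w l)) ∈ M →
      mono m * v - v * const (φ (w m)) ∈ M →
      mono (l + m) * v - v * const (φ (w (l + m))) ∈ M := by
    intro l m hl hm
    have := M.add_mem (M.mono_mul_mem hm l) (M.mul_mem hl (const (φ (w m))))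
    rw [hw, map_mul, const_mul, mono_add]
    convert this using 1
    noncomm_ring
  have hzero : mono 0 * v - v * const (φ (w 0)) ∈ M := by
    have h1 : (AddMonoidAlgebra.single 0 1 : SlicePoly n) = 1 := rfl
    simp [w, h1]
  have hmono : ∀ l, mono l * v - v * const (φ (w l)) ∈ M := by
    intro l
    induction l using Finsupp.induction_linear with
    | zero => exact hzero
    | add l m hl hm => exact hadd l m hl hm
    | single i k =>
      induction k with
      | zero => simpa using hzero
      | succ k ih =>
        rw [Finsupp.single_add]
        refine hadd _ _ ih ?_
        have hwi : w (Finsupp.single i 1) = z i := by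
          simp only [w]
          rw [Finset.prod_eq_single i (fun j _ hj => by simp [Finsupp.single_eq_of_ne hj])
            (by simp)]
          simp
        rw [hwi]
        exact hv i
  induction Q using AddMonoidAlgebra.induction_linear with
  | zero => simp [eval_zero]
  | add P Q hP hQ =>
    rw [eval_add, const_add]
    convert M.add_mem hP hQ using 1
    noncomm_ring
  | single l c =>
    have hl := M.mul_mem (hmono l) (const c)
    have hs : (AddMonoidAlgebra.single l c : SlicePoly n) = mono l * const c := by
      simp [AddMonoidAlgebra.single_mul_single]
    rw [eval_single_slice, const_mul, hs]
    convert hl using 1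
    rw [sub_mul, mono_mul_comm l v, mul_assoc, mul_assoc]

/-- Suppose that modulo `M` each variable is a zero of a complex quadratic with distinct roots.
Then `1` is a sum of common eigenvectors of the variables with complex eigenvalues. Hence an
additive property of all common eigenvectors holds for `1`. -/
lemma one_mem_of_eigenvectors_mem (M : RightIdeal n) (D : AddSubgroup (SlicePoly n))
    (hM : ∀ i, ∃ α β : ℂ, α ≠ β ∧ ∀ v, var i * (var i * v) -
      var i * v * const (ofComplex (α + β)) + v * const (ofComplex (α * β)) ∈ M)
    (hD : ∀ v, (∀ i, ∃ ζ : ℂ, var i * v - v * const (ofComplex ζ) ∈ M) → v ∈ D) :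
    1 ∈ D := by
  -- `s` holds the variables whose eigencomponents are still to be split off.
  suffices H : ∀ (s : Finset (Fin n)) (v : SlicePoly n),
      (∀ i ∉ s, ∃ ζ : ℂ, var i * v - v * const (ofComplex ζ) ∈ M) → v ∈ D from
    H Finset.univ 1 (by simp)
  intro s
  induction s using Finset.induction_on with
  | empty => exact fun v hv => hD v fun i => hv i (by simp)
  | insert i s _ ih =>
    intro v hv
    obtain ⟨α, β, hne, hq⟩ := hM i
    -- `(qᵢ v - v γ) δ` is an eigenvector of `qᵢ` when `γ` is one root, with the other root as
    -- eigenvalue, and stays an eigenvector of the other variables.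
    have key : ∀ γ γ' δ : ℂ, γ + γ' = α + β → γ * γ' = α * β →
        (var i * v - v * const (ofComplex γ)) * const (ofComplex δ) ∈ D := by
      intro γ γ' δ hs hp
      refine ih _ fun j hj => ?_
      by_cases hji : j = i
      · subst hji
        refine ⟨γ', ?_⟩
        have := M.mul_mem (hq v) (const (ofComplex δ))
        convert this using 1
        rw [← hs, ← hp, map_add, map_mul, const_add, const_mul,
          mul_assoc _ (const (ofComplex δ)) (const (ofComplex γ')), const_ofComplex_mul_comm δ γ']
        noncomm_ring
      · obtain ⟨ζ, hζ⟩ := hv j (by simp [hji, hj])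
        refine ⟨ζ, ?_⟩
        have := M.mul_mem (M.sub_mem (M.mono_mul_mem hζ (Finsupp.single i 1))
          (M.mul_mem hζ (const (ofComplex γ)))) (const (ofComplex δ))
        convert this using 1
        rw [mul_assoc _ (const (ofComplex δ)) (const (ofComplex ζ)), const_ofComplex_mul_comm δ ζ]
        simp only [mul_sub, sub_mul, mul_assoc]
        rw [← mul_assoc (const (ofComplex γ)) (const (ofComplex ζ)), const_ofComplex_mul_comm γ ζ,
          ← mul_assoc (var j) (var i), mono_mul_comm (Finsupp.single j 1) (var i)]
        simp only [mul_assoc]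
        abel
    have h1 := key β α (α - β)⁻¹ (add_comm _ _) (mul_comm _ _)
    have h2 := key α β (α - β)⁻¹ rfl rfl
    convert D.sub_mem h1 h2 using 1
    have h3 : (const (ofComplex α) - const (ofComplex β)) * const (ofComplex (α - β)⁻¹) =
        (1 : SlicePoly n) := by
      rw [← const_sub, ← map_sub, ← const_mul, ← map_mul,
        mul_inv_cancel₀ (sub_ne_zero.2 hne), map_one]
      rfl
    rw [← sub_mul, sub_sub_sub_cancel_left, ← mul_sub, mul_assoc, h3, mul_one]

/-- The embedding `z ↦ g z g⁻¹` of `ℂ` onto the slice obtained by conjugating `ℂ ⊆ ℍ` by `g`. -/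
def conjHom (g : ℍ[ℝ]) (hg : g ≠ 0) : ℂ →ₐ[ℝ] ℍ[ℝ] :=
  AlgHom.ofLinearMap
    { toFun := fun z => g * ofComplex z * g⁻¹
      map_add' := fun x y => by simp [mul_add, add_mul]
      map_smul' := fun r x => by
        rw [map_smul, mul_smul_comm, smul_mul_assoc, RingHom.id_apply] }
    (by simp [hg])
    (fun x y => by simp [mul_assoc, hg])

lemma conjHom_apply (g : ℍ[ℝ]) (hg : g ≠ 0) (z : ℂ) :
    conjHom g hg z = g * ofComplex z * g⁻¹ := rfl

lemma eq_zero_of_const_mem {M : RightIdeal n} {P : SlicePoly n} (hP : P ∉ M) {h : ℍ[ℝ]}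
    (hh : const h ∈ M) : h = 0 := by
  by_contra h0
  refine hP ?_
  have := M.mul_mem (M.mul_mem hh (const h⁻¹)) P
  rw [← const_mul, mul_inv_cancel₀ h0] at this
  have h1 : (const 1 : SlicePoly n) = 1 := rfl
  rwa [h1, one_mul] at this

/-- A right ideal maximal among those missing `P`, modulo which the variables are diagonalizable,
is the ideal of a point on a slice: every `Q` is congruent modulo it to its value there. -/
lemma exists_slice_point_of_maximal (M : RightIdeal n) {P : SlicePoly n} (hP : P ∉ M)
    (hmax : ∀ N : RightIdeal n, M ≤ N → P ∉ N → N ≤ M)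
    (hM : ∀ i, ∃ α β : ℂ, α ≠ β ∧ ∀ v, var i * (var i * v) -
      var i * v * const (ofComplex (α + β)) + v * const (ofComplex (α * β)) ∈ M) :
    ∃ (φ : ℂ →ₐ[ℝ] ℍ[ℝ]) (z : Fin n → ℂ), ∀ Q,
      Q - const (eval (fun i => φ (z i)) Q) ∈ M := by
  have h1 : (1 : SlicePoly n) ∉ M := fun h => hP (by simpa using M.mul_mem h P)
  -- Maximality puts `P` in the right ideal generated by `M` and any eigenvector outside `M`.
  have hP' : ∀ (v : SlicePoly n) (z : Fin n → ℂ),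
      (∀ i, var i * v - v * const (ofComplex (z i)) ∈ M) → v ∉ M →
      ∃ h, P - v * const h ∈ M := by
    intro v z hz hv
    have hmem : P ∈ M ⊔ Submodule.span (SlicePoly n)ᵐᵒᵖ {v} := by
      by_contra hc
      exact hv (hmax _ le_sup_left hc
        (Submodule.mem_sup_right (Submodule.mem_span_singleton_self v)))
    obtain ⟨m, hm, y, hy, rfl⟩ := Submodule.mem_sup.1 hmem
    obtain ⟨Q, rfl⟩ := Submodule.mem_span_singleton.1 hy
    refine ⟨eval (fun i => ofComplex (z i)) Q.unop, ?_⟩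
    convert M.add_mem hm (mul_sub_mul_const_eval_mem M ofComplex z hz Q.unop) using 1
    rw [add_sub_assoc]
    rfl
  obtain ⟨v, hv, hvM⟩ : ∃ v, (∀ i, ∃ ζ : ℂ, var i * v - v * const (ofComplex ζ) ∈ M) ∧ v ∉ M := by
    by_contra! hc
    exact h1 (one_mem_of_eigenvectors_mem M M.toAddSubgroup hM hc)
  choose z hz using hv
  obtain ⟨h, hh⟩ := hP' v z hz hvM
  -- All eigenvectors lie in `M + v ℍ`, hence so does `1`.
  let D : AddSubgroup (SlicePoly n) :=
    { carrier := {u | ∃ k, u - v * const k ∈ M}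
      zero_mem' := ⟨0, by simp⟩
      add_mem' := by
        rintro x y ⟨k, hk⟩ ⟨l, hl⟩
        refine ⟨k + l, ?_⟩
        convert M.add_mem hk hl using 1
        rw [const_add, mul_add]
        abel
      neg_mem' := by
        rintro x ⟨k, hk⟩
        refine ⟨-k, ?_⟩
        convert M.neg_mem hk using 1
        rw [const_neg, mul_neg]
        abel }
  obtain ⟨k, hk⟩ : 1 ∈ D := by
    refine one_mem_of_eigenvectors_mem M D hM fun u hu => ?_
    by_cases huM : u ∈ M
    · exact ⟨0, by simpa using huM⟩
    choose y hy using hu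
    obtain ⟨l, hl⟩ := hP' u y hy huM
    have hl0 : l ≠ 0 := by
      rintro rfl
      exact hP (by simpa using hl)
    refine ⟨h * l⁻¹, ?_⟩
    have h2 := M.mul_mem (M.sub_mem hh hl) (const l⁻¹)
    have h3 : (const l * const l⁻¹ : SlicePoly n) = 1 := by
      rw [← const_mul, mul_inv_cancel₀ hl0]; rfl
    convert h2 using 1
    rw [sub_sub_sub_cancel_left, sub_mul, mul_assoc u, h3, mul_one, const_mul, mul_assoc]
  have hk0 : k ≠ 0 := by
    rintro rfl
    exact h1 (by simpa using hk)
  -- Thus `v` is congruent to the constant `k⁻¹`, and `qᵢ` to `k⁻¹ zᵢ k`.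
  have hki : k⁻¹ ≠ 0 := inv_ne_zero hk0
  refine ⟨conjHom k⁻¹ hki, z, fun Q => ?_⟩
  have := mul_sub_mul_const_eval_mem M (conjHom k⁻¹ hki) z (v := 1) ?_ Q
  · simpa using this
  intro i
  have hkk : (const k * const k⁻¹ : SlicePoly n) = 1 := by
    rw [← const_mul, mul_inv_cancel₀ hk0]; rfl
  have hkk' : (const k⁻¹ * const k : SlicePoly n) = 1 := by
    rw [← const_mul, inv_mul_cancel₀ hk0]; rfl
  have e1 := M.mono_mul_mem hk (Finsupp.single i 1)
  have e2 := M.mul_mem (hz i) (const k)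
  have e3 := M.mul_mem (M.mul_mem (M.mul_mem hk (const k⁻¹)) (const (ofComplex (z i)))) (const k)
  convert M.sub_mem (M.add_mem e1 e2) e3 using 1
  rw [conjHom_apply, inv_inv, const_mul, const_mul]
  simp only [sub_mul, mul_sub, mul_one, one_mul, mul_assoc]
  rw [← mul_assoc (const k) (const k⁻¹), hkk, one_mul]
  abel

/-! ### The quadratic equations of the coordinates -/

/-- Every quaternion is a zero of a real quadratic polynomial with distinct complex roots. -/
lemma exists_quadratic (q : ℍ[ℝ]) : ∃ (s t : ℝ) (α β : ℂ), α ≠ β ∧ α + β = s ∧ α * β = t ∧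
    q * q = s • q - t • (1 : ℍ[ℝ]) := by
  by_cases hq : q.imI ^ 2 + q.imJ ^ 2 + q.imK ^ 2 = 0
  · -- A real `q` is the root of `(x - q) (x - q - 1)`.
    refine ⟨2 * q.re + 1, q.re * (q.re + 1), q.re, q.re + 1, by simp, by push_cast; ring,
      by push_cast; ring, ?_⟩
    have h1 : q.imI = 0 := by nlinarith [sq_nonneg q.imI, sq_nonneg q.imJ, sq_nonneg q.imK]
    have h2 : q.imJ = 0 := by nlinarith [sq_nonneg q.imI, sq_nonneg q.imJ, sq_nonneg q.imK]
    have h3 : q.imK = 0 := by nlinarith [sq_nonneg q.imI, sq_nonneg q.imJ, sq_nonneg q.imK]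
    ext <;> simp [h1, h2, h3]
    ring
  · set r := Real.sqrt (q.imI ^ 2 + q.imJ ^ 2 + q.imK ^ 2) with hr
    have hrr : r * r = q.imI ^ 2 + q.imJ ^ 2 + q.imK ^ 2 := Real.mul_self_sqrt (by positivity)
    have hr0 : r ≠ 0 := by
      intro h
      rw [h] at hrr
      exact hq (by linarith)
    refine ⟨2 * q.re, q.re ^ 2 + r * r, ⟨q.re, r⟩, ⟨q.re, -r⟩, ?_, ?_, ?_, ?_⟩
    · intro h
      have := congrArg Complex.im h
      simp only at this
      exact hr0 (by linarith)
    · apply Complex.ext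
      · simp
        ring
      · simp
    · apply Complex.ext
      · simp [pow_two]
      · simp [pow_two]
        ring
    · rw [hrr]
      ext <;> simp <;> ring

/-- The values of `qᵢ² R`, `qᵢ R` and `R` at `a` satisfy the real quadratic relation of `aᵢ`,
although `aᵢ` need not commute with the other coordinates. -/
lemma eval_quadratic (a : Fin n → ℍ[ℝ]) (i : Fin n) {s t : ℝ}
    (h : a i * a i = s • a i - t • (1 : ℍ[ℝ])) (R : SlicePoly n) :
    eval a (var i * (var i * R)) = s • eval a (var i * R) - t • eval a R := by
  induction R using AddMonoidAlgebra.induction_linear with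
  | zero => simp [eval_zero]
  | add P Q hP hQ => simp only [mul_add, eval_add, hP, hQ, smul_add]; abel
  | single l c =>
    simp only [AddMonoidAlgebra.single_mul_single, one_mul, eval_single]
    let F := MultilinearMap.mkPiAlgebraFin ℝ n ℍ[ℝ]
    have hF : ∀ m : Fin n →₀ ℕ, (∀ j ≠ i, m j = l j) → (List.ofFn fun j => a j ^ m j).prod =
        F (Function.update (fun j => a j ^ l j) i (a i ^ m i)) := by
      intro m hm
      rw [MultilinearMap.mkPiAlgebraFin_apply]
      congr 2
      funext j
      by_cases hj : j = i
      · subst hj; simp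
      · simp [hj, hm j hj]
    rw [hF _ (fun j hj => by simp [Finsupp.single_eq_of_ne hj]),
      hF _ (fun j hj => by simp [Finsupp.single_eq_of_ne hj]), hF l (fun _ _ => rfl)]
    have hp : a i ^ (Finsupp.single i 1 + (Finsupp.single i 1 + l) : Fin n →₀ ℕ) i =
        s • a i ^ (Finsupp.single i 1 + l : Fin n →₀ ℕ) i - t • a i ^ l i := by
      simp only [Finsupp.add_apply, Finsupp.single_eq_same, pow_add, pow_one]
      rw [← mul_assoc, h, sub_mul, smul_mul_assoc, smul_mul_assoc, one_mul]
    rw [hp, MultilinearMap.map_update_sub, MultilinearMap.map_update_smul,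
      MultilinearMap.map_update_smul, sub_mul, smul_mul_assoc, smul_mul_assoc]

/-- The largest right ideal all of whose members vanish at `a`. -/
def pointIdeal (a : Fin n → ℍ[ℝ]) : RightIdeal n where
  carrier := {P | ∀ Q, eval a (P * Q) = 0}
  zero_mem' Q := by simp [eval_zero]
  add_mem' hP hQ R := by rw [add_mul, eval_add, hP R, hQ R, add_zero]
  smul_mem' Q P hP R := by
    change eval a (P * Q.unop * R) = 0
    rw [mul_assoc]
    exact hP _

lemma le_pointIdeal {I : RightIdeal n} {a : Fin n → ℍ[ℝ]} (ha : a ∈ zeroLocus I) :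
    I ≤ pointIdeal a :=
  fun _ hP Q => ha _ (I.mul_mem hP Q)

lemma eval_eq_zero_of_mem_pointIdeal {a : Fin n → ℍ[ℝ]} {P : SlicePoly n}
    (hP : P ∈ pointIdeal a) : eval a P = 0 := by
  simpa using hP 1

lemma pointIdeal_quadratic (a : Fin n → ℍ[ℝ]) (i : Fin n) : ∃ α β : ℂ, α ≠ β ∧ ∀ v,
    var i * (var i * v) - var i * v * const (ofComplex (α + β)) +
      v * const (ofComplex (α * β)) ∈ pointIdeal a := by
  obtain ⟨s, t, α, β, hne, hs, ht, h⟩ := exists_quadratic (a i)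
  refine ⟨α, β, hne, fun v Q => ?_⟩
  rw [hs, ht, coe_ofComplex, coeComplex_coe, coeComplex_coe, add_mul, sub_mul, eval_add, eval_sub]
  simp only [mul_assoc]
  have hc : ∀ r : ℝ, const (r : ℍ[ℝ]) * Q = Q * const (r : ℍ[ℝ]) := fun r =>
    AddMonoidAlgebra.single_commute (fun m => AddCommute.all 0 m)
      (fun x => Quaternion.coe_commute r x) Q
  rw [eval_quadratic a i h, hc, hc, ← mul_assoc v, ← mul_assoc (var i), ← mul_assoc v,
    ← mul_assoc (var i), mul_assoc (var i), eval_mul_const, eval_mul_const,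
    Quaternion.mul_coe_eq_smul, Quaternion.mul_coe_eq_smul]
  abel

lemma exists_maximal_notMem {N : RightIdeal n} {P : SlicePoly n} (hP : P ∉ N) :
    ∃ M : RightIdeal n, N ≤ M ∧ P ∉ M ∧ ∀ M' : RightIdeal n, M ≤ M' → P ∉ M' → M' ≤ M := by
  obtain ⟨M, hNM, hM⟩ := zorn_le_nonempty₀ {M : RightIdeal n | P ∉ M} (fun c hc hchain y hy =>
    ⟨sSup c, fun h => by
      obtain ⟨M, hMc, hPM⟩ := (Submodule.mem_sSup_of_directed ⟨y, hy⟩ hchain.directedOn).1 h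
      exact hc hMc hPM, fun z hz => le_sSup hz⟩) N hP
  exact ⟨M, hNM, hM.prop, fun M' hle hP' => hM.le_of_ge hP' hle⟩

/-- A polynomial vanishing on the points of `𝒱(I)` that lie on a slice vanishes on all of `𝒱(I)`. -/
theorem vanishingOn_sliceZeroLocus_subset (I : RightIdeal n) :
    vanishingOn (sliceZeroLocus I) ⊆ vanishingOn (zeroLocus I) := by
  intro P hP a ha
  refine eval_eq_zero_of_mem_pointIdeal ?_
  by_contra hPa
  obtain ⟨M, haM, hPM, hmax⟩ := exists_maximal_notMem hPa
  obtain ⟨φ, z, hφ⟩ := exists_slice_point_of_maximal M hPM hmax fun i => by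
    obtain ⟨α, β, hne, h⟩ := pointIdeal_quadratic a i
    exact ⟨α, β, hne, fun v => haM (h v)⟩
  have hb : (fun i => φ (z i)) ∈ sliceZeroLocus I := by
    refine ⟨fun Q hQ => ?_, Set.mem_iUnion₂.2 ⟨φ Complex.I, (mem_slice_algHom φ).1,
      fun i => (mem_slice_algHom φ).2 _⟩⟩
    refine eq_zero_of_const_mem hPM ?_
    convert M.sub_mem (haM (le_pointIdeal ha hQ)) (hφ Q) using 1
    abel
  have := hφ P
  rw [hP _ hb] at this
  exact hPM (by simpa using this)

end SliceRegular

end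

theorem theorem4p1 (n : ℕ) (I : SliceRegular.RightIdeal n) :
    (SliceRegular.idealJ (SliceRegular.sliceZeroLocus I) : Set (SliceRegular.SlicePoly n)) ⊆
      SliceRegular.vanishingOn (SliceRegular.zeroLocus I) :=
  (SliceRegular.idealJ_sliceZeroLocus_subset I).trans
    (SliceRegular.vanishingOn_sliceZeroLocus_subset I)
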